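/- Theorem 2.4. Let $\Bbbk$ be an infinite field of arbitrary characteristic, let $n, s, d_1, \ldots, d_s$ be positive integers, $S = \Bbbk[x_1,\ldots,x_n]$ with the standard grading, and let $\preceq$ be a monomial order on $S$ with $x_1 \succeq \cdots \succeq x_n$. Let $N = \sum_{i=1}^s \binom{n+d_i-1}{d_i}$ and identify a point $\mathbf a \in \mathbb A^N_\Bbbk = \Bbbk^N$ with the coefficients of an $s$-tuple of forms $f_1,\ldots,f_s \in S$ of degrees $d_1,\ldots,d_s$ (zero forms allowed); put $I_{\mathbf a} = (f_1,\ldots,f_s)$. For an ideal $I \subset S$ let $\mathrm{in}_\preceq(I)$ be the initial ideal, i.e. the $\Bbbk$-span of the initial terms of the elements of $I$. Call an ideal $J \subset S$ Borel-fixed if $\alpha \cdot J = J$ for every invertible upper triangular matrix $\alpha = (\alpha_{i,j}) \in \mathrm{GL}_n(\Bbbk)$, where $\alpha$ acts on $S$ by the substitution $x_j \mapsto \sum_{i=1}^n \alpha_{i,j} x_i$. Then there is an ideal $J \subset S$ such that: 1. the set $\{\mathbf a \in \mathbb A^N_\Bbbk : \mathrm{in}_\preceq(I_{\mathbf a}) =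 J\}$ is Zariski open and dense in $\mathbb A^N_\Bbbk$; 2. if $V \subset \mathbb A^N_\Bbbk$ is any Zariski open dense set such that $\mathrm{in}_\preceq(I_{\mathbf a})$ is the same for all $\mathbf a \in V$, then $\mathrm{in}_\preceq(I_{\mathbf a}) = J$ for all $\mathbf a \in V$; 3. $J$ is Borel-fixed. That is, the common initial ideal of the $V$-generic ideals is Borel-fixed. -/

import Mathlib

namespace GenericInitial

open MvPolynomial

section Zariski

/-- The Zariski topology on the affine space `𝔸_k^ι`, identified with its set of `k`-rational
points `ι → k`: the closed sets are the zero loci of ideals of `k[t_i | i ∈ ι]`. -/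
@[reducible]
def zariskiTopology (k : Type*) [Field k] (ι : Type*) : TopologicalSpace (ι → k) :=
  TopologicalSpace.ofClosed {Z | ∃ I : Ideal (MvPolynomial ι k), Z = zeroLocus k I}
    ⟨⊤, zeroLocus_top.symm⟩
    (by
      intro A hA
      refine ⟨sSup {I | zeroLocus k I ∈ A}, ?_⟩
      ext x
      simp only [Set.mem_sInter]
      constructor
      · intro h
        have key : sSup {I : Ideal (MvPolynomial ι k) | zeroLocus k I ∈ A} ≤
            RingHom.ker (aeval x : MvPolynomial ι k →ₐ[k] k) := by
          refine sSup_le fun I hI p hp => ?_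
          exact h _ hI p hp
        exact fun p hp => key hp
      · intro h Z hZ
        obtain ⟨I, rfl⟩ := hA hZ
        exact zeroLocus_anti_mono (le_sSup (show I ∈ {I | zeroLocus k I ∈ A} from hZ)) h)
    (by
      rintro _ ⟨I, rfl⟩ _ ⟨J, rfl⟩
      refine ⟨I * J, ?_⟩
      ext x
      constructor
      · rintro (h | h)
        · exact zeroLocus_anti_mono Ideal.mul_le_left h
        · exact zeroLocus_anti_mono Ideal.mul_le_right h
      · intro h
        by_contra hx
        simp only [Set.mem_union, not_or, mem_zeroLocus_iff, not_forall] at hx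
        obtain ⟨⟨p, hp, hpx⟩, ⟨q, hq, hqx⟩⟩ := hx
        have := h (p * q) (Ideal.mul_mem_mul hp hq)
        rw [map_mul] at this
        exact (mul_ne_zero hpx hqx) this)

/-- `V` is a Zariski open dense subset of the affine space `𝔸_k^ι`. -/
def IsZariskiOpenDense {k : Type*} [Field k] {ι : Type*} (V : Set (ι → k)) : Prop :=
  @IsOpen (ι → k) (zariskiTopology k ι) V ∧ @Dense (ι → k) (zariskiTopology k ι) V

end Zariski

section Ideals

/-- The exponent vectors of the monomials of degree `d` in `n` variables. -/
def monomialsOfDegree (n d : ℕ) : Finset (Fin n →₀ ℕ) :=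
  Finset.finsuppAntidiag Finset.univ d

/-- The index set of the coefficients of `s` forms of degrees `d 0, …, d (s - 1)` in `n` variables:
pairs of an index `i` and a monomial of degree `d i`. -/
abbrev CoeffIndex (n s : ℕ) (d : Fin s → ℕ) : Type :=
  Σ i : Fin s, {e : Fin n →₀ ℕ // e ∈ monomialsOfDegree n (d i)}

/-- The form `f_i = ∑ a_{i,e} x^e` (sum over the monomials `x^e` of degree `d i`) with coefficient
vector `a`. -/
noncomputable def form {k : Type*} [Field k] {n s : ℕ} {d : Fin s → ℕ}
    (a : CoeffIndex n s d → k) (i : Fin s) : MvPolynomial (Fin n) k :=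
  ∑ e : {e : Fin n →₀ ℕ // e ∈ monomialsOfDegree n (d i)}, monomial e.1 (a ⟨i, e⟩)

/-- The ideal `I_a = (f_1, …, f_s)` corresponding to the point `a` of the affine space. -/
noncomputable def idealOfPoint {k : Type*} [Field k] {n s : ℕ} {d : Fin s → ℕ}
    (a : CoeffIndex n s d → k) : Ideal (MvPolynomial (Fin n) k) :=
  Ideal.span (Set.range (form a))

/-- The initial ideal of `I`: the ideal generated by the initial terms of the elements of `I`.
It is also their `k`-linear span, see `initialIdeal_restrictScalars`. -/
noncomputable def initialIdeal {k : Type*} [Field k] {n : ℕ} (m : MonomialOrder (Fin n))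
    (I : Ideal (MvPolynomial (Fin n) k)) : Ideal (MvPolynomial (Fin n) k) :=
  Ideal.span (m.leadingTerm '' (I : Set (MvPolynomial (Fin n) k)))

theorem initialIdeal_restrictScalars {k : Type*} [Field k] {n : ℕ} (m : MonomialOrder (Fin n))
    (I : Ideal (MvPolynomial (Fin n) k)) :
    (initialIdeal m I).restrictScalars k =
      Submodule.span k (m.leadingTerm '' (I : Set (MvPolynomial (Fin n) k))) := by
  have hmul : ∀ (p x : MvPolynomial (Fin n) k),
      x ∈ Submodule.span k (m.leadingTerm '' (I : Set (MvPolynomial (Fin n) k))) →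
      p * x ∈ Submodule.span k (m.leadingTerm '' (I : Set (MvPolynomial (Fin n) k))) := by
    intro p x hx
    induction p using MvPolynomial.induction_on' with
    | add p q hp hq =>
      rw [add_mul]
      exact Submodule.add_mem _ hp hq
    | monomial u c =>
      induction hx using Submodule.span_induction with
      | mem y hy =>
        obtain ⟨f, hf, rfl⟩ := hy
        refine Submodule.subset_span ⟨monomial u c * f, I.mul_mem_left _ hf, ?_⟩
        rw [m.leadingTerm_mul, m.leadingTerm_monomial]
      | zero => simp
      | add y z _ _ h1 h2 =>
        rw [mul_add]
        exact Submodule.add_mem _ h1 h2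
      | smul r y _ h1 =>
        rw [mul_smul_comm]
        exact Submodule.smul_mem _ _ h1
  apply le_antisymm
  · let K : Ideal (MvPolynomial (Fin n) k) :=
      { Submodule.span k (m.leadingTerm '' (I : Set (MvPolynomial (Fin n) k))) with
        smul_mem' := fun p x hx => hmul p x hx }
    have h : initialIdeal m I ≤ K := Ideal.span_le.2 fun x hx => Submodule.subset_span hx
    exact fun x hx => h hx
  · exact Submodule.span_le_restrictScalars k (MvPolynomial (Fin n) k) _

/-- The action of `α ∈ GL_n(k)` on polynomials by linear substitution:
`x_j ↦ ∑ i, α i j * x_i`. -/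
noncomputable def linearSubst {k : Type*} [Field k] {n : ℕ} (α : GL (Fin n) k) :
    MvPolynomial (Fin n) k →ₐ[k] MvPolynomial (Fin n) k :=
  aeval fun j => ∑ i, C ((α : Matrix (Fin n) (Fin n) k) i j) * X i

/-- `J` is Borel-fixed: `α • J = J` for every invertible upper triangular matrix `α`. -/
def IsBorelFixed {k : Type*} [Field k] {n : ℕ} (J : Ideal (MvPolynomial (Fin n) k)) : Prop :=
  ∀ α : GL (Fin n) k, (α : Matrix (Fin n) (Fin n) k).BlockTriangular id →
    linearSubst α '' (J : Set (MvPolynomial (Fin n) k)) = J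

end Ideals

end GenericInitial

namespace GenericInitial

open MvPolynomial

/-! ### Determinants: triangularity and top coefficients. -/

section Matrix

/-! Fix a degree `e` and a threshold `c`. The number of leading exponents of `I_a` of degree `e` and
at least `c` (`leadingCount`) is the rank of the projection of the degree `e` part of `I_a` to the
coefficients at monomials at least `c`. A nonvanishing minor stays nonzero on a Zariski
neighbourhood of `a`, so this count is lower semicontinuous (`isOpen_le_leadingCount`) and is
maximal on a nonempty open set. The counts over all `c` recover the leading exponents of degree `e`
(`forall_mem_iff_of_card_eq`). So they are constant on `genericPoints e`, and these values over all
`e` form `genericExponents`. By Dickson's lemma finitely many degrees decide the ideal, and a finite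
intersection of nonempty open sets is nonempty because affine space over an infinite field is
irreducible.

Borel-fixedness is also a maximality argument (`mem_genericExponents_of_mem_support`). If an upper
triangular substitution took a generic leading monomial `x^u` outside the span of the generic
monomials, triangularity would give a nonzero minor of the transformed initial ideal with one row
too many. A suitable diagonal substitution lifts this minor from the initial ideal to a transform of
`I_a` (`exists_card_le_leadingCount`), so some point would have a count above the maximum. -/

theorem det_ne_zero_of_triangular {R ι α : Type*} [CommRing R] [IsDomain R] [Fintype ι]
    [DecidableEq ι] [LinearOrder α] (M : Matrix ι ι R) (key : ι → α)
    (hkey : Function.Injective key) (hM : ∀ i j, key i < key j → M i j = 0)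
    (hdiag : ∀ i, M i i ≠ 0) : M.det ≠ 0 := by
  let : LinearOrder ι := LinearOrder.lift' key hkey
  have hlt : M.IsLowerTriangular := fun i j hij => hM i j hij
  rw [Matrix.det_of_isLowerTriangular M hlt]
  exact Finset.prod_ne_zero_iff.2 fun i _ => hdiag i

theorem toSyn_degree_prod_le_of_le {σ R ι : Type*} [CommRing R] (m : MonomialOrder σ)
    (s : Finset ι) (P : ι → MvPolynomial σ R) (v : ι → σ →₀ ℕ)
    (h : ∀ i ∈ s, m.toSyn (m.degree (P i)) ≤ m.toSyn (v i)) :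
    m.toSyn (m.degree (∏ i ∈ s, P i)) ≤ m.toSyn (∑ i ∈ s, v i) := by
  refine m.degree_prod_le.trans ?_
  rw [map_sum, map_sum]
  exact Finset.sum_le_sum h

theorem coeff_sum_prod_of_degree_le {σ R ι : Type*} [CommRing R] (m : MonomialOrder σ)
    (s : Finset ι) (P : ι → MvPolynomial σ R) (v : ι → σ →₀ ℕ)
    (h : ∀ i ∈ s, m.toSyn (m.degree (P i)) ≤ m.toSyn (v i)) :
    coeff (∑ i ∈ s, v i) (∏ i ∈ s, P i) = ∏ i ∈ s, coeff (v i) (P i) := by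
  classical
  induction s using Finset.induction_on with
  | empty => simp
  | insert a s ha ih =>
    rw [Finset.prod_insert ha, Finset.sum_insert ha, Finset.prod_insert ha,
      m.coeff_mul_of_add_of_degree_le (h a (Finset.mem_insert_self a s))
        (toSyn_degree_prod_le_of_le m s P v fun i hi => h i (Finset.mem_insert_of_mem hi)),
      ih fun i hi => h i (Finset.mem_insert_of_mem hi)]

/-- If the entries of the `j`-th column have degree at most `v j`, the coefficient of the
determinant at `∑ v j` is the determinant of the top coefficients. -/
theorem coeff_sum_det_of_degree_le {σ R ι : Type*} [CommRing R] [Fintype ι] [DecidableEq ι]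
    (m : MonomialOrder σ) (P : Matrix ι ι (MvPolynomial σ R)) (v : ι → σ →₀ ℕ)
    (h : ∀ i j, m.toSyn (m.degree (P i j)) ≤ m.toSyn (v j)) :
    coeff (∑ j, v j) P.det = (Matrix.of fun i j => coeff (v j) (P i j)).det := by
  rw [Matrix.det_apply', Matrix.det_apply', coeff_sum]
  refine Finset.sum_congr rfl fun τ _ => ?_
  have hsign : ((Equiv.Perm.sign τ : ℤ) : MvPolynomial σ R) =
      C ((Equiv.Perm.sign τ : ℤ) : R) := by simp
  rw [hsign, coeff_C_mul, coeff_sum_prod_of_degree_le m _ _ _ fun i _ => h _ i]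
  rfl

end Matrix

/-! ### Zariski-open sets and irreducibility of affine space. -/

section ZariskiFacts

variable {k : Type*} [Field k] {ι : Type*}

theorem exists_eval_ne_zero_of_isOpen {U : Set (ι → k)}
    (hU : @IsOpen (ι → k) (zariskiTopology k ι) U) {a : ι → k} (ha : a ∈ U) :
    ∃ q : MvPolynomial ι k, eval a q ≠ 0 ∧ ∀ b, eval b q ≠ 0 → b ∈ U := by
  obtain ⟨I, hI⟩ : ∃ I : Ideal (MvPolynomial ι k), Uᶜ = zeroLocus k I := hU
  have ha' : a ∉ zeroLocus k I := hI ▸ fun h => h ha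
  simp only [mem_zeroLocus_iff, not_forall] at ha'
  obtain ⟨q, hq, hqa⟩ := ha'
  refine ⟨q, by simpa [aeval_eq_eval] using hqa, fun b hb => ?_⟩
  by_contra hbU
  have : b ∈ zeroLocus k I := hI ▸ hbU
  exact hb (by simpa [aeval_eq_eval] using this q hq)

theorem isOpen_of_forall_exists_eval_ne_zero {U : Set (ι → k)}
    (h : ∀ a ∈ U, ∃ q : MvPolynomial ι k, eval a q ≠ 0 ∧ ∀ b, eval b q ≠ 0 → b ∈ U) :
    @IsOpen (ι → k) (zariskiTopology k ι) U := by
  refine ⟨vanishingIdeal k Uᶜ, ?_⟩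
  ext a
  constructor
  · intro ha p hp
    exact hp a ha
  · intro ha haU
    obtain ⟨q, hqa, hq⟩ := h a haU
    refine hqa ?_
    have := ha q (fun b hb => by
      by_contra hne
      exact hb (hq b (by simpa [aeval_eq_eval] using hne)))
    simpa [aeval_eq_eval] using this

variable [Infinite k]

/-- Each set contains the nonvanishing locus of a nonzero polynomial. The product of the two is
nonzero, hence nonzero at some point of an infinite field's affine space. -/
theorem nonempty_inter_of_isOpen {U V : Set (ι → k)}
    (hU : @IsOpen (ι → k) (zariskiTopology k ι) U) (hV : @IsOpen (ι → k) (zariskiTopology k ι) V)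
    (hU' : U.Nonempty) (hV' : V.Nonempty) : (U ∩ V).Nonempty := by
  obtain ⟨a, ha⟩ := hU'
  obtain ⟨b, hb⟩ := hV'
  obtain ⟨p, hpa, hp⟩ := exists_eval_ne_zero_of_isOpen hU ha
  obtain ⟨q, hqb, hq⟩ := exists_eval_ne_zero_of_isOpen hV hb
  have hne : p * q ≠ 0 := mul_ne_zero (by rintro rfl; simp at hpa) (by rintro rfl; simp at hqb)
  obtain ⟨x, hx⟩ : ∃ x, eval x (p * q) ≠ 0 := by
    by_contra! hx
    exact hne (MvPolynomial.funext fun x => by simpa using hx x)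
  rw [map_mul] at hx
  exact ⟨x, hp x (left_ne_zero_of_mul hx), hq x (right_ne_zero_of_mul hx)⟩

theorem isZariskiOpenDense_of_isOpen {U : Set (ι → k)}
    (hU : @IsOpen (ι → k) (zariskiTopology k ι) U) (hU' : U.Nonempty) : IsZariskiOpenDense U := by
  let := zariskiTopology k ι
  refine ⟨hU, dense_iff_inter_open.2 fun V hV hV' => nonempty_inter_of_isOpen hV hU hV' hU'⟩

theorem nonempty_biInter_of_isOpen {α : Type*} (s : Finset α) (U : α → Set (ι → k))
    (hU : ∀ i ∈ s, @IsOpen (ι → k) (zariskiTopology k ι) (U i))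
    (hU' : ∀ i ∈ s, (U i).Nonempty) :
    @IsOpen (ι → k) (zariskiTopology k ι) (⋂ i ∈ s, U i) ∧ (⋂ i ∈ s, U i).Nonempty := by
  classical
  let := zariskiTopology k ι
  refine ⟨isOpen_biInter_finset hU, ?_⟩
  induction s using Finset.induction_on with
  | empty => simp
  | insert a s ha ih =>
    rw [Finset.set_biInter_insert]
    have h1 : ∀ i ∈ s, IsOpen (U i) := fun i hi => hU i (Finset.mem_insert_of_mem hi)
    exact nonempty_inter_of_isOpen (hU a (Finset.mem_insert_self a s)) (isOpen_biInter_finset h1)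
      (hU' a (Finset.mem_insert_self a s))
      (ih h1 fun i hi => hU' i (Finset.mem_insert_of_mem hi))

end ZariskiFacts

/-! ### Leading exponents and their count as a rank. -/

section LeadingExponents

variable {k : Type*} [Field k] {n : ℕ} (m : MonomialOrder (Fin n))

/-- The exponents of the leading monomials of the nonzero elements of an ideal. -/
def leadingExponents (I : Ideal (MvPolynomial (Fin n) k)) : Set (Fin n →₀ ℕ) :=
  {u | ∃ f ∈ I, f ≠ 0 ∧ m.degree f = u}

theorem add_mem_leadingExponents {I : Ideal (MvPolynomial (Fin n) k)} {u : Fin n →₀ ℕ}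
    (hu : u ∈ leadingExponents m I) (v : Fin n →₀ ℕ) : u + v ∈ leadingExponents m I := by
  classical
  obtain ⟨f, hf, hf0, rfl⟩ := hu
  have hv : (monomial v (1 : k)) ≠ 0 := by simp
  refine ⟨monomial v 1 * f, I.mul_mem_left _ hf, mul_ne_zero hv hf0, ?_⟩
  rw [m.degree_mul hv hf0, m.degree_monomial, if_neg one_ne_zero, add_comm]

theorem initialIdeal_eq_span_monomial (I : Ideal (MvPolynomial (Fin n) k)) :
    initialIdeal m I = Ideal.span ((fun u => monomial u (1 : k)) '' leadingExponents m I) := by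
  apply le_antisymm
  · refine Ideal.span_le.2 ?_
    rintro _ ⟨f, hf, rfl⟩
    by_cases hf0 : f = 0
    · simp [hf0]
    · have : m.leadingTerm f = C (m.leadingCoeff f) * monomial (m.degree f) 1 := by
        rw [C_mul_monomial, mul_one]; rfl
      rw [this]
      exact Ideal.mul_mem_left _ _ (Ideal.subset_span ⟨_, ⟨f, hf, hf0, rfl⟩, rfl⟩)
  · refine Ideal.span_le.2 ?_
    rintro _ ⟨_, ⟨f, hf, hf0, rfl⟩, rfl⟩
    have : monomial (m.degree f) (1 : k) = C (m.leadingCoeff f)⁻¹ * m.leadingTerm f := by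
      rw [MonomialOrder.leadingTerm, C_mul_monomial,
        inv_mul_cancel₀ (m.leadingCoeff_ne_zero_iff.2 hf0)]
    simp only [this]
    exact Ideal.mul_mem_left _ _ (Ideal.subset_span ⟨f, hf, rfl⟩)

/-- A monomial ideal whose set of exponents `G` is closed under addition determines `G`. -/
theorem mem_span_monomial_iff {G : Set (Fin n →₀ ℕ)} (hG : ∀ u ∈ G, ∀ v, u + v ∈ G)
    (p : MvPolynomial (Fin n) k) :
    p ∈ Ideal.span ((fun u => monomial u (1 : k)) '' G) ↔ ∀ u ∈ p.support, u ∈ G := by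
  rw [mem_ideal_span_monomial_image]
  refine forall₂_congr fun u _ => ⟨?_, fun h => ⟨u, h, le_rfl⟩⟩
  rintro ⟨v, hv, hvu⟩
  rw [← add_tsub_cancel_of_le hvu]
  exact hG v hv _

theorem span_monomial_inj {G H : Set (Fin n →₀ ℕ)} (hG : ∀ u ∈ G, ∀ v, u + v ∈ G)
    (hH : ∀ u ∈ H, ∀ v, u + v ∈ H)
    (h : Ideal.span ((fun u => monomial u (1 : k)) '' G) =
      Ideal.span ((fun u => monomial u (1 : k)) '' H)) : G = H := by
  classical
  ext u
  have h1 := mem_span_monomial_iff (k := k) hG (monomial u 1)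
  have h2 := mem_span_monomial_iff (k := k) hH (monomial u 1)
  rw [h, h2] at h1
  simpa [support_monomial] using h1.symm

/-- The exponents of degree `e` that are at least `c` in the monomial order. -/
noncomputable def exponentsGE (e : ℕ) (c : Fin n →₀ ℕ) : Finset (Fin n →₀ ℕ) :=
  (monomialsOfDegree n e).filter fun u => m.toSyn c ≤ m.toSyn u

theorem mem_monomialsOfDegree {e : ℕ} {u : Fin n →₀ ℕ} :
    u ∈ monomialsOfDegree n e ↔ u.degree = e := by
  simp [monomialsOfDegree, Finsupp.degree_eq_sum]

theorem mem_exponentsGE {e : ℕ} {c u : Fin n →₀ ℕ} :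
    u ∈ exponentsGE m e c ↔ u.degree = e ∧ m.toSyn c ≤ m.toSyn u := by
  rw [exponentsGE, Finset.mem_filter, mem_monomialsOfDegree]

open Classical in
/-- The elements of `T` that are leading exponents of `I`. -/
noncomputable def leadingIn (I : Ideal (MvPolynomial (Fin n) k)) (T : Finset (Fin n →₀ ℕ)) :
    Finset (Fin n →₀ ℕ) :=
  T.filter (· ∈ leadingExponents m I)

theorem mem_leadingIn {I : Ideal (MvPolynomial (Fin n) k)} {T : Finset (Fin n →₀ ℕ)}
    {u : Fin n →₀ ℕ} : u ∈ leadingIn m I T ↔ u ∈ T ∧ u ∈ leadingExponents m I := by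
  classical
  rw [leadingIn, Finset.mem_filter]

/-- The order need not refine degree, so pass to the degree `e` component, which stays in `I`. If it
has a term at or above `c`, its leading exponent lies in `leadingIn`, where the coefficient is
assumed to vanish. -/
theorem coeff_eq_zero_of_forall_leadingIn {I : Ideal (MvPolynomial (Fin n) k)}
    (hI : ∀ f ∈ I, ∀ e, homogeneousComponent e f ∈ I) {e : ℕ} {c : Fin n →₀ ℕ}
    {f : MvPolynomial (Fin n) k} (hf : f ∈ I)
    (h : ∀ u ∈ leadingIn m I (exponentsGE m e c), coeff u f = 0) :
    ∀ u ∈ exponentsGE m e c, coeff u f = 0 := by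
  intro u hu
  by_contra hne
  rw [mem_exponentsGE] at hu
  have hcomp : ∀ v : Fin n →₀ ℕ, coeff v (homogeneousComponent e f) =
      if v.degree = e then coeff v f else 0 := fun v => coeff_homogeneousComponent e f v
  set g := homogeneousComponent e f with hg
  have hug : coeff u g ≠ 0 := by rw [hcomp, if_pos hu.1]; exact hne
  have hg0 : g ≠ 0 := by rintro h0; rw [h0] at hug; simp at hug
  have hlead : coeff (m.degree g) g ≠ 0 := m.coeff_degree_ne_zero_iff.2 hg0
  have hdeg : (m.degree g).degree = e := by
    by_contra h'
    rw [hcomp, if_neg h'] at hlead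
    exact hlead rfl
  rw [hcomp, if_pos hdeg] at hlead
  exact hlead (h _ ((mem_leadingIn m).2 ⟨(mem_exponentsGE m).2
    ⟨hdeg, hu.2.trans (m.le_degree (mem_support_iff.2 hug))⟩, g, hI f hf e, hg0, rfl⟩))

/-- A combination of the `g j` that vanishes at the leading exponents vanishes at every `h i`, hence
is trivial by the minor. So the columns restricted to the leading exponents are still independent.
-/
theorem card_le_of_det_ne_zero {I : Ideal (MvPolynomial (Fin n) k)}
    (hI : ∀ f ∈ I, ∀ e, homogeneousComponent e f ∈ I) {e : ℕ} {c : Fin n →₀ ℕ}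
    {ι : Type*} [Fintype ι] [DecidableEq ι] (g : ι → MvPolynomial (Fin n) k) (hg : ∀ i, g i ∈ I)
    (h : ι → Fin n →₀ ℕ) (hh : ∀ i, h i ∈ exponentsGE m e c)
    (hdet : (Matrix.of fun i j => coeff (h i) (g j)).det ≠ 0) :
    Fintype.card ι ≤ (leadingIn m I (exponentsGE m e c)).card := by
  let φ : (ι → k) →ₗ[k] (leadingIn m I (exponentsGE m e c) → k) :=
    Matrix.mulVecLin (Matrix.of fun u j => coeff u.1 (g j))
  have hφ : Function.Injective φ := by
    rw [← LinearMap.ker_eq_bot, LinearMap.ker_eq_bot']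
    intro x hx
    have hsum : ∀ u : Fin n →₀ ℕ, coeff u (∑ j, C (x j) * g j) = ∑ j, coeff u (g j) * x j := by
      intro u
      rw [coeff_sum]
      exact Finset.sum_congr rfl fun j _ => by rw [coeff_C_mul, mul_comm]
    have hvan := coeff_eq_zero_of_forall_leadingIn m hI (e := e) (c := c)
      (f := ∑ j, C (x j) * g j) (Ideal.sum_mem _ fun j _ => I.mul_mem_left _ (hg j))
      (fun u hu => by
        rw [hsum]
        exact congrFun hx ⟨u, hu⟩)
    by_contra hx0
    refine hdet (Matrix.exists_mulVec_eq_zero_iff.1 ⟨x, hx0, ?_⟩)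
    funext i
    exact (hsum (h i)).symm.trans (hvan _ (hh i))
  have := LinearMap.finrank_le_finrank_of_injective hφ
  simpa using this

/-- Elements of `I` with distinct prescribed leading exponents give a triangular matrix. This is the
converse to `card_le_of_det_ne_zero`: the count is attained by a minor. -/
theorem exists_det_ne_zero (I : Ideal (MvPolynomial (Fin n) k)) (T : Finset (Fin n →₀ ℕ)) :
    ∃ g : leadingIn m I T → MvPolynomial (Fin n) k, (∀ u, g u ∈ I) ∧
      (Matrix.of fun i j : leadingIn m I T => coeff i.1 (g j)).det ≠ 0 := by
  have hex : ∀ u : leadingIn m I T, ∃ f ∈ I, f ≠ 0 ∧ m.degree f = u.1 := fun u =>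
    ((mem_leadingIn m).1 u.2).2
  choose g hgI hg0 hg using hex
  refine ⟨g, hgI, det_ne_zero_of_triangular _ (fun u => OrderDual.toDual (m.toSyn u.1)) ?_ ?_ ?_⟩
  · intro u v huv
    exact Subtype.ext (m.toSyn.injective huv)
  · intro i j hij
    refine m.coeff_eq_zero_of_lt ?_
    rw [hg j]
    exact hij
  · intro i
    change coeff i.1 (g i) ≠ 0
    rw [← hg i]
    exact m.coeff_degree_ne_zero_iff.2 (hg0 i)

/-- A subset of the exponents of degree `e` is determined by the number of its elements above
each threshold. -/
theorem forall_mem_iff_of_card_eq {e : ℕ} {A B : Finset (Fin n →₀ ℕ)}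
    (hA : A ⊆ monomialsOfDegree n e) (hB : B ⊆ monomialsOfDegree n e)
    (h : ∀ c ∈ monomialsOfDegree n e,
      (A.filter fun u => m.toSyn c ≤ m.toSyn u).card =
        (B.filter fun u => m.toSyn c ≤ m.toSyn u).card) : A = B := by
  classical
  by_contra hne
  have hS : (symmDiff A B).Nonempty := by
    rw [Finset.nonempty_iff_ne_empty]
    intro h0
    exact hne (symmDiff_eq_bot.1 h0)
  -- Above the largest disagreement `c` the sets coincide, so their counts at threshold `c` differ.
  obtain ⟨c, hc, hmax⟩ := Finset.exists_max_image (symmDiff A B) (fun u => m.toSyn u) hS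
  have key : ∀ A B : Finset (Fin n →₀ ℕ), c ∈ A → c ∉ B →
      (∀ u, u ∈ symmDiff A B → m.toSyn u ≤ m.toSyn c) →
      (B.filter fun u => m.toSyn c ≤ m.toSyn u).card <
        (A.filter fun u => m.toSyn c ≤ m.toSyn u).card := by
    intro A B hcA hcB hmax
    refine Finset.card_lt_card ⟨fun u hu => ?_, fun hsub => ?_⟩
    · rw [Finset.mem_filter] at hu ⊢
      refine ⟨?_, hu.2⟩
      by_contra huA
      have := hmax u (Finset.mem_symmDiff.2 (Or.inr ⟨hu.1, huA⟩))
      have : u = c := m.toSyn.injective (le_antisymm this hu.2)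
      exact hcB (this ▸ hu.1)
    · have := hsub (Finset.mem_filter.2 ⟨hcA, le_rfl⟩)
      exact hcB (Finset.mem_filter.1 this).1
  rcases Finset.mem_symmDiff.1 hc with ⟨h1, h2⟩ | ⟨h1, h2⟩
  · exact (key A B h1 h2 hmax).ne' (h c (hA h1))
  · exact (key B A h1 h2 (by rwa [symmDiff_comm])).ne (h c (hB h1))

end LeadingExponents

end GenericInitial

namespace GenericInitial

open MvPolynomial

/-! ### Semicontinuity of the counts and the generic leading exponents. -/

section GenericPoints

variable {k : Type*} [Field k] {n s : ℕ} {d : Fin s → ℕ} (m : MonomialOrder (Fin n))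

theorem isHomogeneous_form (a : CoeffIndex n s d → k) (i : Fin s) :
    (form a i).IsHomogeneous (d i) :=
  IsHomogeneous.sum _ _ _ fun e _ =>
    isHomogeneous_monomial _ (mem_monomialsOfDegree.1 e.2)

theorem mem_idealOfPoint_iff {a : CoeffIndex n s d → k} {f : MvPolynomial (Fin n) k} :
    f ∈ idealOfPoint a ↔ ∃ p : Fin s → MvPolynomial (Fin n) k, ∑ i, p i * form a i = f :=
  Ideal.mem_span_range_iff_exists_fun

theorem homogeneousComponent_mem_idealOfPoint (a : CoeffIndex n s d → k) :
    ∀ f ∈ idealOfPoint a, ∀ e, homogeneousComponent e f ∈ idealOfPoint a := by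
  intro f hf e
  let _ := gradedAlgebra (σ := Fin n) (R := k)
  refine homogeneousComponent_mem_of_mem (Ideal.homogeneous_span _ _ ?_) hf e
  rintro _ ⟨i, rfl⟩
  exact ⟨d i, isHomogeneous_form a i⟩

/-- The coefficient at `u` of the combination `∑ p i * form a i`, as a polynomial in `a`. -/
noncomputable def coeffCombination (d : Fin s → ℕ) (p : Fin s → MvPolynomial (Fin n) k)
    (u : Fin n →₀ ℕ) : MvPolynomial (CoeffIndex n s d) k :=
  ∑ i, ∑ e : {e : Fin n →₀ ℕ // e ∈ monomialsOfDegree n (d i)},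
    C (coeff u (p i * monomial e.1 1)) * X ⟨i, e⟩

theorem eval_coeffCombination (p : Fin s → MvPolynomial (Fin n) k) (u : Fin n →₀ ℕ)
    (a : CoeffIndex n s d → k) :
    eval a (coeffCombination d p u) = coeff u (∑ i, p i * form a i) := by
  simp only [coeffCombination, map_sum, map_mul, eval_C, eval_X, coeff_sum, form, Finset.mul_sum]
  refine Finset.sum_congr rfl fun i _ => Finset.sum_congr rfl fun e _ => ?_
  have : monomial e.1 (a ⟨i, e⟩) = C (a ⟨i, e⟩) * monomial e.1 (1 : k) := by
    rw [C_mul_monomial, mul_one]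
  rw [this, mul_left_comm, coeff_C_mul, mul_comm]

/-- The number of leading exponents of `idealOfPoint a` of degree `e` that are at least `c`. -/
noncomputable def leadingCount (e : ℕ) (c : Fin n →₀ ℕ) (a : CoeffIndex n s d → k) : ℕ :=
  (leadingIn m (idealOfPoint a) (exponentsGE m e c)).card

/-- Keep the multipliers `p` of a nonzero minor at `a` and vary the point: the minor is a polynomial
in the coefficients, and where it is nonzero the count is at least that at `a`. -/
theorem isOpen_le_leadingCount (e : ℕ) (c : Fin n →₀ ℕ) (r : ℕ) :
    @IsOpen (CoeffIndex n s d → k) (zariskiTopology k _) {a | r ≤ leadingCount m e c a} := by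
  classical
  refine isOpen_of_forall_exists_eval_ne_zero fun a ha => ?_
  obtain ⟨g, hg, hdet⟩ := exists_det_ne_zero m (idealOfPoint a) (exponentsGE m e c)
  choose p hp using fun u => mem_idealOfPoint_iff.1 (hg u)
  let ι := leadingIn m (idealOfPoint a) (exponentsGE m e c)
  have heval : ∀ b : CoeffIndex n s d → k,
      eval b (Matrix.of fun i j : ι => coeffCombination d (p j) i.1).det =
        (Matrix.of fun i j : ι => coeff i.1 (∑ l, p j l * form b l)).det := by
    intro b
    rw [RingHom.map_det]
    congr 1
    ext i j
    exact eval_coeffCombination (p j) i b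
  refine ⟨(Matrix.of fun i j : ι => coeffCombination d (p j) i.1).det, ?_, fun b hb => ?_⟩
  · rw [heval a]
    simpa only [hp] using hdet
  · rw [heval b] at hb
    have := card_le_of_det_ne_zero m (homogeneousComponent_mem_idealOfPoint b)
      (fun j => ∑ l, p j l * form b l) (fun j => mem_idealOfPoint_iff.2 ⟨p j, rfl⟩) (fun i => i.1)
      (fun i => ((mem_leadingIn m).1 i.2).1) hb
    rw [Fintype.card_coe] at this
    exact le_trans ha this

/-- The points at which every `leadingCount` in degree `e` is maximal. -/
def genericPoints (d : Fin s → ℕ) (k : Type*) [Field k] (e : ℕ) : Set (CoeffIndex n s d → k) :=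
  ⋂ c ∈ insert 0 (monomialsOfDegree n e),
    {a | ∀ b : CoeffIndex n s d → k, leadingCount m e c b ≤ leadingCount m e c a}

theorem leadingCount_le {e : ℕ} {a : CoeffIndex n s d → k} (ha : a ∈ genericPoints m d k e)
    {c : Fin n →₀ ℕ} (hc : c = 0 ∨ c.degree = e) (b : CoeffIndex n s d → k) :
    leadingCount m e c b ≤ leadingCount m e c a := by
  have := Set.mem_iInter₂.1 ha c
    (Finset.mem_insert.2 (hc.imp id fun h => mem_monomialsOfDegree.2 h))
  exact this b

theorem exists_forall_leadingCount_le (d : Fin s → ℕ) (k : Type*) [Field k] (e : ℕ)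
    (c : Fin n →₀ ℕ) : ∃ a : CoeffIndex n s d → k, ∀ b : CoeffIndex n s d → k,
      leadingCount m e c b ≤ leadingCount m e c a := by
  have hbdd : BddAbove (Set.range (leadingCount (k := k) (d := d) m e c)) := by
    refine ⟨(exponentsGE m e c).card, ?_⟩
    rintro _ ⟨a, rfl⟩
    exact Finset.card_le_card fun u hu => ((mem_leadingIn m).1 hu).1
  obtain ⟨a, ha⟩ := Nat.sSup_mem (Set.range_nonempty _) hbdd
  exact ⟨a, fun b => (le_csSup hbdd ⟨b, rfl⟩).trans_eq ha.symm⟩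

theorem isOpen_nonempty_genericPoints [Infinite k] (e : ℕ) :
    @IsOpen (CoeffIndex n s d → k) (zariskiTopology k _) (genericPoints m d k e) ∧
      (genericPoints m d k e).Nonempty := by
  refine nonempty_biInter_of_isOpen _ _ (fun c _ => ?_)
    (fun c _ => exists_forall_leadingCount_le m d k e c)
  obtain ⟨a, ha⟩ := exists_forall_leadingCount_le m d k e c
  convert isOpen_le_leadingCount (k := k) (d := d) m e c (leadingCount m e c a) using 1
  ext b
  exact ⟨fun h => h a, fun h x => (ha x).trans h⟩

theorem mem_leadingExponents_iff_of_genericPoints {e : ℕ} {a b : CoeffIndex n s d → k}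
    (ha : a ∈ genericPoints m d k e) (hb : b ∈ genericPoints m d k e) {u : Fin n →₀ ℕ}
    (hu : u.degree = e) :
    u ∈ leadingExponents m (idealOfPoint a) ↔ u ∈ leadingExponents m (idealOfPoint b) := by
  have hfilter : ∀ (x : CoeffIndex n s d → k) (c : Fin n →₀ ℕ),
      ((leadingIn m (idealOfPoint x) (monomialsOfDegree n e)).filter
        fun u => m.toSyn c ≤ m.toSyn u) = leadingIn m (idealOfPoint x) (exponentsGE m e c) := by
    intro x c
    ext v
    simp only [Finset.mem_filter, mem_leadingIn, exponentsGE]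
    tauto
  have hsub : ∀ x : CoeffIndex n s d → k,
      leadingIn m (idealOfPoint x) (monomialsOfDegree n e) ⊆ monomialsOfDegree n e :=
    fun x v hv => ((mem_leadingIn m).1 hv).1
  have h := forall_mem_iff_of_card_eq m (hsub a) (hsub b) fun c hc => by
    rw [hfilter, hfilter]
    have hc' : c = 0 ∨ c.degree = e := Or.inr (mem_monomialsOfDegree.1 hc)
    exact le_antisymm (leadingCount_le m hb hc' a) (leadingCount_le m ha hc' b)
  have h' := Finset.ext_iff.1 h u
  rw [mem_leadingIn, mem_leadingIn] at h'
  simpa [mem_monomialsOfDegree.2 hu] using h'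

/-- The leading exponents of the generic ideals. -/
def genericExponents (d : Fin s → ℕ) (k : Type*) [Field k] : Set (Fin n →₀ ℕ) :=
  {u | ∃ a ∈ genericPoints m d k u.degree, u ∈ leadingExponents m (idealOfPoint a)}

theorem mem_genericExponents_iff {e : ℕ} {a : CoeffIndex n s d → k}
    (ha : a ∈ genericPoints m d k e) {u : Fin n →₀ ℕ} (hu : u.degree = e) :
    u ∈ genericExponents m d k ↔ u ∈ leadingExponents m (idealOfPoint a) := by
  subst hu
  constructor
  · rintro ⟨b, hb, hub⟩
    exact (mem_leadingExponents_iff_of_genericPoints m ha hb rfl).2 hub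
  · exact fun h => ⟨a, ha, h⟩

/-- The two degrees have different generic sets; a point common to both reduces the claim to a
single ideal. -/
theorem add_mem_genericExponents [Infinite k] {u : Fin n →₀ ℕ}
    (hu : u ∈ genericExponents m d k) (v : Fin n →₀ ℕ) : u + v ∈ genericExponents m d k := by
  obtain ⟨h1, h1'⟩ := isOpen_nonempty_genericPoints (k := k) (d := d) m u.degree
  obtain ⟨h2, h2'⟩ := isOpen_nonempty_genericPoints (k := k) (d := d) m (u + v).degree
  obtain ⟨a, ha1, ha2⟩ := nonempty_inter_of_isOpen h1 h2 h1' h2'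
  rw [mem_genericExponents_iff m ha1 rfl] at hu
  exact (mem_genericExponents_iff m ha2 rfl).2 (add_mem_leadingExponents m hu v)

/-- Dickson's lemma: the minimal elements form an antichain, hence a finite set. -/
theorem exists_degree_bound (G : Set (Fin n →₀ ℕ)) :
    ∃ D : ℕ, ∀ u ∈ G, ∃ v ∈ G, v ≤ u ∧ v.degree ≤ D := by
  have hfin : {v | Minimal (· ∈ G) v}.Finite :=
    WellQuasiOrderedLE.finite_of_isAntichain (setOfPred_minimal_antichain _)
  obtain ⟨D, hD⟩ := (hfin.image Finsupp.degree).bddAbove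
  refine ⟨D, fun u hu => ?_⟩
  obtain ⟨v, hvu, hv⟩ := exists_minimal_le_of_wellFoundedLT (· ∈ G) u hu
  exact ⟨v, hv.prop, hvu, hD ⟨v, hv, rfl⟩⟩

/-- Threshold `0` counts every exponent of degree `e`; it was put into `genericPoints` for this
step. One inclusion together with the maximal count forces equality. -/
theorem leadingIn_exponentsGE_zero_eq {e : ℕ} {a b : CoeffIndex n s d → k}
    (ha : a ∈ genericPoints m d k e)
    (h : genericExponents m d k ⊆ leadingExponents m (idealOfPoint b)) :
    leadingIn m (idealOfPoint a) (exponentsGE m e 0) =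
      leadingIn m (idealOfPoint b) (exponentsGE m e 0) := by
  refine Finset.eq_of_subset_of_card_le (fun u hu => ?_) (leadingCount_le m ha (Or.inl rfl) b)
  rw [mem_leadingIn] at hu ⊢
  exact ⟨hu.1, h ((mem_genericExponents_iff m ha ((mem_exponentsGE m).1 hu.1).1).2 hu.2)⟩

theorem mem_exponentsGE_zero (u : Fin n →₀ ℕ) : u ∈ exponentsGE m u.degree 0 := by
  rw [mem_exponentsGE]
  exact ⟨rfl, m.toSyn_monotone (zero_le)⟩

theorem leadingExponents_eq_of_subset [Infinite k] {b : CoeffIndex n s d → k}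
    (h : genericExponents m d k ⊆ leadingExponents m (idealOfPoint b)) :
    leadingExponents m (idealOfPoint b) = genericExponents m d k := by
  refine Set.Subset.antisymm (fun u hu => ?_) h
  obtain ⟨a, ha⟩ := (isOpen_nonempty_genericPoints (k := k) (d := d) m u.degree).2
  have := (leadingIn_exponentsGE_zero_eq m ha h).symm ▸
    (mem_leadingIn m).2 ⟨mem_exponentsGE_zero m u, hu⟩
  exact (mem_genericExponents_iff m ha rfl).2 ((mem_leadingIn m).1 this).2

theorem mem_genericPoints_of_leadingExponents_eq [Infinite k] {b : CoeffIndex n s d → k}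
    (h : leadingExponents m (idealOfPoint b) = genericExponents m d k) (e : ℕ) :
    b ∈ genericPoints m d k e := by
  obtain ⟨a, ha⟩ := (isOpen_nonempty_genericPoints (k := k) (d := d) m e).2
  refine Set.mem_iInter₂.2 fun c hc x => ?_
  have hle := leadingCount_le m ha
    ((Finset.mem_insert.1 hc).imp id fun h => mem_monomialsOfDegree.1 h) x
  have heq : leadingIn m (idealOfPoint a) (exponentsGE m e c) =
      leadingIn m (idealOfPoint b) (exponentsGE m e c) := by
    ext u
    rw [mem_leadingIn, mem_leadingIn, h]
    exact and_congr_right fun hu => (mem_genericExponents_iff m ha ((mem_exponentsGE m).1 hu).1).symm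
  exact hle.trans_eq (congrArg Finset.card heq)

/-- Genericity in degrees up to `D` yields the generators of the generic exponents, hence all of
them, and maximality of the counts excludes any further exponent. -/
theorem isOpen_nonempty_leadingExponents_eq [Infinite k] :
    @IsOpen (CoeffIndex n s d → k) (zariskiTopology k _)
        {a | leadingExponents m (idealOfPoint a) = genericExponents m d k} ∧
      {a : CoeffIndex n s d → k |
        leadingExponents m (idealOfPoint a) = genericExponents m d k}.Nonempty := by
  obtain ⟨D, hD⟩ := exists_degree_bound (genericExponents m d k)
  have h := nonempty_biInter_of_isOpen (Finset.range (D + 1)) (genericPoints m d k)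
    (fun e _ => (isOpen_nonempty_genericPoints m e).1)
    (fun e _ => (isOpen_nonempty_genericPoints m e).2)
  convert h using 3 <;>
  · ext b
    refine ⟨fun hb => Set.mem_iInter₂.2 fun e _ =>
      mem_genericPoints_of_leadingExponents_eq m hb e, fun hb => ?_⟩
    refine leadingExponents_eq_of_subset m fun u hu => ?_
    obtain ⟨v, hv, hvu, hvD⟩ := hD u hu
    have hb' := Set.mem_iInter₂.1 hb v.degree (Finset.mem_range.2 (Nat.lt_succ_of_le hvD))
    rw [← add_tsub_cancel_of_le hvu]
    exact add_mem_leadingExponents m ((mem_genericExponents_iff m hb' rfl).1 hv) _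

end GenericPoints

end GenericInitial

namespace GenericInitial

open MvPolynomial

/-! ### Linear substitutions and the lift from the initial ideal by a diagonal matrix. -/

section MatrixSubstitution

variable {k : Type*} [Field k] {n s : ℕ} {d : Fin s → ℕ} (m : MonomialOrder (Fin n))

/-- The substitution `x_j ↦ ∑ i, M i j * x_i` for an arbitrary square matrix `M`. -/
noncomputable def matrixSubst (M : Matrix (Fin n) (Fin n) k) :
    MvPolynomial (Fin n) k →ₐ[k] MvPolynomial (Fin n) k :=
  aeval fun j => ∑ i, C (M i j) * X i

theorem matrixSubst_X (M : Matrix (Fin n) (Fin n) k) (j : Fin n) :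
    matrixSubst M (X j) = ∑ i, C (M i j) * X i :=
  aeval_X _ j

theorem matrixSubst_monomial (M : Matrix (Fin n) (Fin n) k) (v : Fin n →₀ ℕ) :
    matrixSubst M (monomial v 1) = ∏ j, matrixSubst M (X j) ^ v j := by
  rw [monomial_eq, C_1, one_mul, Finsupp.prod_fintype _ _ fun j => pow_zero _, map_prod]
  exact Finset.prod_congr rfl fun j _ => map_pow _ _ _

theorem matrixSubst_matrixSubst (M N : Matrix (Fin n) (Fin n) k) (p : MvPolynomial (Fin n) k) :
    matrixSubst M (matrixSubst N p) = matrixSubst (M * N) p := by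
  have : (matrixSubst M).comp (matrixSubst N) = matrixSubst (M * N) := by
    refine algHom_ext fun j => ?_
    have hC : ∀ c : k, matrixSubst M (C c) = C c := fun c => (matrixSubst M).commutes c
    simp only [AlgHom.comp_apply, matrixSubst_X, map_sum, map_mul, hC, Matrix.mul_apply,
      Finset.mul_sum, Finset.sum_mul]
    rw [Finset.sum_comm]
    exact Finset.sum_congr rfl fun i _ => Finset.sum_congr rfl fun l _ => by ring
  exact DFunLike.congr_fun this p

theorem matrixSubst_one (p : MvPolynomial (Fin n) k) : matrixSubst 1 p = p := by
  have : matrixSubst (1 : Matrix (Fin n) (Fin n) k) = AlgHom.id k _ := by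
    refine algHom_ext fun j => ?_
    rw [matrixSubst_X, Finset.sum_eq_single j]
    · simp
    · intro i _ hij
      simp [Matrix.one_apply_ne hij]
    · simp
  rw [this, AlgHom.id_apply]

theorem isHomogeneous_matrixSubst (M : Matrix (Fin n) (Fin n) k) {p : MvPolynomial (Fin n) k}
    {e : ℕ} (hp : p.IsHomogeneous e) : (matrixSubst M p).IsHomogeneous e := by
  have := hp.aeval (S := k) (fun j => ∑ i, C (M i j) * X i) (n := 1) fun j =>
    IsHomogeneous.sum _ _ _ fun i _ => by
      simpa using (isHomogeneous_C (Fin n) (M i j)).mul (isHomogeneous_X k i)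
  rwa [one_mul] at this

theorem exists_form_eq (p : Fin s → MvPolynomial (Fin n) k) (hp : ∀ i, (p i).IsHomogeneous (d i)) :
    ∃ a : CoeffIndex n s d → k, ∀ i, form a i = p i := by
  classical
  refine ⟨fun x => coeff x.2.1 (p x.1), fun i => ?_⟩
  ext u
  simp only [form, coeff_sum, coeff_monomial]
  by_cases hu : u ∈ monomialsOfDegree n (d i)
  · rw [Finset.sum_eq_single ⟨u, hu⟩]
    · simp
    · intro e _ he
      exact if_neg fun h => he (Subtype.ext h)
    · simp
  · have hz : coeff u (p i) = 0 := by
      by_contra h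
      refine hu (mem_monomialsOfDegree.2 ?_)
      rw [Finsupp.degree_eq_weight_one]
      exact hp i h
    rw [hz]
    refine Finset.sum_eq_zero fun e _ => if_neg ?_
    rintro rfl
    exact hu e.2

/-- Transformed forms keep their degrees, so they are the forms of another point. `M` may be
singular; only this inclusion is needed. -/
theorem exists_matrixSubst_mem (M : Matrix (Fin n) (Fin n) k) (a : CoeffIndex n s d → k) :
    ∃ b : CoeffIndex n s d → k, ∀ f ∈ idealOfPoint a, matrixSubst M f ∈ idealOfPoint b := by
  obtain ⟨b, hb⟩ := exists_form_eq (fun i => matrixSubst M (form a i))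
    fun i => isHomogeneous_matrixSubst M (isHomogeneous_form a i)
  refine ⟨b, fun f hf => ?_⟩
  obtain ⟨p, rfl⟩ := mem_idealOfPoint_iff.1 hf
  refine mem_idealOfPoint_iff.2 ⟨fun i => matrixSubst M (p i), ?_⟩
  simp [hb]

/-- The coefficient at `w` of `g` transformed by `M * diagonal t`, as a polynomial in `t`. -/
noncomputable def torusCoeff (M : Matrix (Fin n) (Fin n) k) (w : Fin n →₀ ℕ)
    (g : MvPolynomial (Fin n) k) : MvPolynomial (Fin n) k :=
  ∑ v ∈ g.support, monomial v (coeff v g * coeff w (matrixSubst M (monomial v 1)))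

theorem matrixSubst_mul_diagonal_monomial (M : Matrix (Fin n) (Fin n) k) (t : Fin n → k)
    (v : Fin n →₀ ℕ) : matrixSubst (M * Matrix.diagonal t) (monomial v 1) =
      C (∏ j, t j ^ v j) * matrixSubst M (monomial v 1) := by
  have hX : ∀ j, matrixSubst (M * Matrix.diagonal t) (X j) = C (t j) * matrixSubst M (X j) := by
    intro j
    rw [matrixSubst_X, matrixSubst_X, Finset.mul_sum]
    refine Finset.sum_congr rfl fun i _ => ?_
    rw [Matrix.mul_diagonal, C_mul]
    ring
  simp only [matrixSubst_monomial, hX, mul_pow, Finset.prod_mul_distrib, map_prod, map_pow]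

theorem matrixSubst_eq_sum (M : Matrix (Fin n) (Fin n) k) (g : MvPolynomial (Fin n) k) :
    matrixSubst M g = ∑ v ∈ g.support, C (coeff v g) * matrixSubst M (monomial v 1) := by
  conv_lhs => rw [g.as_sum, map_sum]
  refine Finset.sum_congr rfl fun v _ => ?_
  have : monomial v (coeff v g) = coeff v g • monomial v (1 : k) := by
    rw [smul_monomial, smul_eq_mul, mul_one]
  rw [this, map_smul, smul_eq_C_mul]

theorem eval_torusCoeff (M : Matrix (Fin n) (Fin n) k) (w : Fin n →₀ ℕ)
    (g : MvPolynomial (Fin n) k) (t : Fin n → k) :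
    eval t (torusCoeff M w g) = coeff w (matrixSubst (M * Matrix.diagonal t) g) := by
  rw [torusCoeff, map_sum, matrixSubst_eq_sum, coeff_sum]
  refine Finset.sum_congr rfl fun v _ => ?_
  rw [matrixSubst_mul_diagonal_monomial, coeff_C_mul, coeff_C_mul, eval_monomial,
    Finsupp.prod_fintype _ _ fun j => pow_zero _]
  ring

/-- The exponent of `t` records which monomial of `g` contributes, so the top coefficient in `t`
sees only the leading term of `g`. -/
theorem coeff_torusCoeff (M : Matrix (Fin n) (Fin n) k) (v w : Fin n →₀ ℕ)
    (g : MvPolynomial (Fin n) k) :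
    coeff v (torusCoeff M w g) = coeff v g * coeff w (matrixSubst M (monomial v 1)) := by
  classical
  simp only [torusCoeff, coeff_sum, coeff_monomial]
  rw [Finset.sum_ite_eq' g.support v]
  split_ifs with h
  · rfl
  · rw [notMem_support_iff.1 h, zero_mul]

theorem degree_torusCoeff_le (M : Matrix (Fin n) (Fin n) k) (w : Fin n →₀ ℕ)
    (g : MvPolynomial (Fin n) k) :
    m.toSyn (m.degree (torusCoeff M w g)) ≤ m.toSyn (m.degree g) := by
  refine m.degree_le_degree_of_support_subset fun v hv => ?_
  rw [mem_support_iff, coeff_torusCoeff] at hv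
  exact mem_support_iff.2 (left_ne_zero_of_mul hv)

/-- Nonvanishing minors of a transform of the initial ideal of `I_a` lift, by means of a generic
diagonal matrix, to nonvanishing minors of the ideal of another point. -/
theorem exists_card_le_leadingCount [Infinite k] (M : Matrix (Fin n) (Fin n) k)
    (a : CoeffIndex n s d → k) {e : ℕ} {c : Fin n →₀ ℕ} {ι : Type*} [Fintype ι] [DecidableEq ι]
    (v : ι → Fin n →₀ ℕ) (hv : ∀ i, v i ∈ leadingExponents m (idealOfPoint a))
    (h : ι → Fin n →₀ ℕ) (hh : ∀ i, h i ∈ exponentsGE m e c)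
    (hdet : (Matrix.of fun i j => coeff (h i) (matrixSubst M (monomial (v j) 1))).det ≠ 0) :
    ∃ b : CoeffIndex n s d → k, Fintype.card ι ≤ leadingCount m e c b := by
  choose g hgI hg0 hg using hv
  let P : Matrix ι ι (MvPolynomial (Fin n) k) := Matrix.of fun i j => torusCoeff M (h i) (g j)
  -- This coefficient is the given minor times the product of the leading coefficients of the `g j`.
  have hP : coeff (∑ j, v j) P.det ≠ 0 := by
    rw [coeff_sum_det_of_degree_le m P v fun i j => hg j ▸ degree_torusCoeff_le m M (h i) (g j)]
    have : (Matrix.of fun i j => coeff (v j) (P i j)) =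
        Matrix.of fun i j => coeff (v j) (g j) *
          (Matrix.of fun i j => coeff (h i) (matrixSubst M (monomial (v j) 1))) i j := by
      ext i j
      exact coeff_torusCoeff M (v j) (h i) (g j)
    rw [this, Matrix.det_mul_row]
    refine mul_ne_zero (Finset.prod_ne_zero_iff.2 fun j _ => ?_) hdet
    rw [← hg j]
    exact m.coeff_degree_ne_zero_iff.2 (hg0 j)
  obtain ⟨t, ht⟩ : ∃ t, eval t P.det ≠ 0 := by
    by_contra! ht
    have : P.det = 0 := MvPolynomial.funext fun t => by simpa using ht t
    rw [this] at hP
    simp at hP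
  obtain ⟨b, hb⟩ := exists_matrixSubst_mem (M * Matrix.diagonal t) a
  refine ⟨b, card_le_of_det_ne_zero m (homogeneousComponent_mem_idealOfPoint b) _
    (fun j => hb _ (hgI j)) h hh ?_⟩
  rw [RingHom.map_det] at ht
  convert ht using 2
  ext i j
  exact (eval_torusCoeff M (h i) (g j) t).symm

end MatrixSubstitution

/-! ### Upper triangular substitutions and Borel-fixedness. -/

section Borel

variable {k : Type*} [Field k] {n s : ℕ} {d : Fin s → ℕ} (m : MonomialOrder (Fin n))

/-- `v` is the smallest exponent of `p` in the monomial order. -/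
def IsLeastExponent (p : MvPolynomial (Fin n) k) (v : Fin n →₀ ℕ) : Prop :=
  coeff v p ≠ 0 ∧ ∀ w, coeff w p ≠ 0 → m.toSyn v ≤ m.toSyn w

variable {m}

theorem IsLeastExponent.one : IsLeastExponent m (1 : MvPolynomial (Fin n) k) 0 := by
  refine ⟨by simp, fun w _ => m.toSyn_monotone (zero_le)⟩

theorem IsLeastExponent.mul {p q : MvPolynomial (Fin n) k} {v w : Fin n →₀ ℕ}
    (hp : IsLeastExponent m p v) (hq : IsLeastExponent m q w) :
    IsLeastExponent m (p * q) (v + w) := by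
  classical
  constructor
  · rw [coeff_mul, Finset.sum_eq_single (v, w)]
    · exact mul_ne_zero hp.1 hq.1
    · rintro ⟨x, y⟩ hxy hne
      by_contra h
      have hx := hp.2 x (left_ne_zero_of_mul h)
      have hy := hq.2 y (right_ne_zero_of_mul h)
      have hsum : m.toSyn x + m.toSyn y = m.toSyn v + m.toSyn w := by
        rw [← map_add, ← map_add, Finset.HasAntidiagonal.mem_antidiagonal.1 hxy]
      have hx' : m.toSyn v = m.toSyn x := by
        refine hx.antisymm (not_lt.1 fun hlt => ?_)
        exact (add_lt_add_of_lt_of_le hlt hy).ne' hsum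
      have hy' : m.toSyn w = m.toSyn y := by
        refine hy.antisymm (not_lt.1 fun hlt => ?_)
        exact (add_lt_add_of_le_of_lt hx hlt).ne' hsum
      exact hne (Prod.ext (m.toSyn.injective hx'.symm) (m.toSyn.injective hy'.symm))
    · simp
  · intro u hu
    rw [coeff_mul] at hu
    obtain ⟨⟨x, y⟩, hxy, h⟩ := Finset.exists_ne_zero_of_sum_ne_zero hu
    rw [← Finset.HasAntidiagonal.mem_antidiagonal.1 hxy, map_add, map_add]
    exact add_le_add (hp.2 x (left_ne_zero_of_mul h)) (hq.2 y (right_ne_zero_of_mul h))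

theorem IsLeastExponent.pow {p : MvPolynomial (Fin n) k} {v : Fin n →₀ ℕ}
    (hp : IsLeastExponent m p v) (e : ℕ) : IsLeastExponent m (p ^ e) (e • v) := by
  induction e with
  | zero => simpa using IsLeastExponent.one
  | succ e ih => simpa [pow_succ, succ_nsmul] using ih.mul hp

theorem IsLeastExponent.prod {ι : Type*} (t : Finset ι) {p : ι → MvPolynomial (Fin n) k}
    {v : ι → Fin n →₀ ℕ} (hp : ∀ i ∈ t, IsLeastExponent m (p i) (v i)) :
    IsLeastExponent m (∏ i ∈ t, p i) (∑ i ∈ t, v i) := by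
  classical
  induction t using Finset.induction_on with
  | empty => simpa using IsLeastExponent.one
  | insert i t hi ih =>
    rw [Finset.prod_insert hi, Finset.sum_insert hi]
    exact (hp i (Finset.mem_insert_self i t)).mul
      (ih fun j hj => hp j (Finset.mem_insert_of_mem hj))

/-- Upper triangularity sends `x_j` to a combination of the `x_i` with `i ≤ j`, all at least `x_j`,
and least exponents add under products. -/
theorem isLeastExponent_matrixSubst_monomial
    (hm : ∀ i j : Fin n, i ≤ j → m.toSyn (Finsupp.single j 1) ≤ m.toSyn (Finsupp.single i 1))
    {M : Matrix (Fin n) (Fin n) k} (hM : M.BlockTriangular id) (hdiag : ∀ i, M i i ≠ 0)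
    (v : Fin n →₀ ℕ) : IsLeastExponent m (matrixSubst M (monomial v 1)) v := by
  classical
  have hX : ∀ j, IsLeastExponent m (matrixSubst M (X j)) (Finsupp.single j 1) := by
    intro j
    have hcoeff : ∀ w, coeff w (matrixSubst M (X j)) =
        ∑ i, if Finsupp.single i 1 = w then M i j else 0 := by
      intro w
      rw [matrixSubst_X, coeff_sum]
      refine Finset.sum_congr rfl fun i _ => ?_
      rw [coeff_C_mul, coeff_X, mul_ite, mul_one, mul_zero]
    constructor
    · rw [hcoeff, Finset.sum_eq_single j]
      · simpa using hdiag j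
      · intro i _ hij
        exact if_neg fun h => hij (Finsupp.single_left_injective one_ne_zero h)
      · simp
    · intro w hw
      rw [hcoeff] at hw
      obtain ⟨i, -, hi⟩ := Finset.exists_ne_zero_of_sum_ne_zero hw
      split_ifs at hi with h
      · rw [← h]
        exact hm i j (not_lt.1 fun hlt => hi (hM hlt))
      · exact absurd rfl hi
  rw [matrixSubst_monomial]
  have hv : v = ∑ j, v j • Finsupp.single j 1 := by
    simp
  conv_rhs => rw [hv]
  exact IsLeastExponent.prod _ fun j _ => (hX j).pow (v j)

theorem mem_genericExponents_of_mem_support [Infinite k]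
    (hm : ∀ i j : Fin n, i ≤ j → m.toSyn (Finsupp.single j 1) ≤ m.toSyn (Finsupp.single i 1))
    {M : Matrix (Fin n) (Fin n) k} (hM : M.BlockTriangular id) (hdiag : ∀ i, M i i ≠ 0)
    {u w : Fin n →₀ ℕ} (hu : u ∈ genericExponents m d k)
    (hw : coeff w (matrixSubst M (monomial u 1)) ≠ 0) : w ∈ genericExponents m d k := by
  classical
  by_contra hwG
  have hleast := fun v => isLeastExponent_matrixSubst_monomial (k := k) hm hM hdiag v
  have hwdeg : w.degree = u.degree := by
    rw [Finsupp.degree_eq_weight_one]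
    have := isHomogeneous_matrixSubst M (isHomogeneous_monomial (R := k) 1 rfl) hw
    rwa [Finsupp.degree_eq_weight_one] at this
  have huw : m.toSyn u < m.toSyn w := by
    refine lt_of_le_of_ne ((hleast u).2 w hw) fun h => hwG ?_
    rwa [← m.toSyn.injective h]
  obtain ⟨a, ha⟩ := (isOpen_nonempty_genericPoints (k := k) (d := d) m u.degree).2
  have hG : ∀ v : Fin n →₀ ℕ, v.degree = u.degree →
      (v ∈ genericExponents m d k ↔ v ∈ leadingExponents m (idealOfPoint a)) :=
    fun v hv => mem_genericExponents_iff m ha hv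
  set T := exponentsGE m u.degree w with hT
  set A := leadingIn m (idealOfPoint a) T with hA
  have hAw : ∀ v ∈ A, v ∈ T ∧ v ∈ leadingExponents m (idealOfPoint a) := fun v hv =>
    (mem_leadingIn m).1 hv
  have hwL : w ∉ leadingExponents m (idealOfPoint a) := fun h => hwG ((hG w hwdeg).2 h)
  have hwA : w ∉ A := fun h => hwL (hAw w h).2
  have hAlt : ∀ v ∈ A, m.toSyn w < m.toSyn v := by
    intro v hv
    refine lt_of_le_of_ne ((mem_exponentsGE m).1 (hAw v hv).1).2 fun h => hwA ?_
    rwa [m.toSyn.injective h]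
  -- Rows are indexed by `A` and `w`. Column `v ∈ A` is the transform of `x^v`; column `w` is the
  -- transform of `x^u`, which contains `x^w`.
  let σ : {i // i ∈ insert w A} → Fin n →₀ ℕ := fun i => if i.1 = w then u else i.1
  have hcases : ∀ i : {i // i ∈ insert w A},
      (i.1 = w ∧ σ i = u) ∨ (i.1 ∈ A ∧ σ i = i.1) := by
    intro i
    by_cases hi : i.1 = w
    · exact Or.inl ⟨hi, if_pos hi⟩
    · exact Or.inr ⟨(Finset.mem_insert.1 i.2).resolve_left hi, if_neg hi⟩
  obtain ⟨b, hb⟩ := exists_card_le_leadingCount m M a (e := u.degree) (c := w) σ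
    (fun i => by
      rcases hcases i with ⟨-, h⟩ | ⟨hi, h⟩
      · rw [h]; exact (hG u rfl).1 hu
      · rw [h]; exact (hAw _ hi).2)
    (fun i => i.1)
    (fun i => by
      rcases hcases i with ⟨h, -⟩ | ⟨hi, -⟩
      · rw [h]; exact (mem_exponentsGE m).2 ⟨hwdeg, le_rfl⟩
      · exact (hAw _ hi).1)
    (by
      -- Column `v ∈ A` vanishes below its least exponent `v`, and no row lies below `w`.
      refine det_ne_zero_of_triangular _ (fun i => m.toSyn i.1) ?_ ?_ ?_
      · intro i j hij
        exact Subtype.ext (m.toSyn.injective hij)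
      · intro i j hij
        change coeff i.1 (matrixSubst M (monomial (σ j) 1)) = 0
        by_contra hne
        rcases hcases j with ⟨hj, -⟩ | ⟨-, hj⟩
        · rcases hcases i with ⟨hi, -⟩ | ⟨hi, -⟩
          · simp only [hi, hj, lt_self_iff_false] at hij
          · simp only [hj] at hij
            exact (hAlt _ hi).not_gt hij
        · rw [hj] at hne
          exact ((hleast _).2 _ hne).not_gt hij
      · intro i
        change coeff i.1 (matrixSubst M (monomial (σ i) 1)) ≠ 0
        rcases hcases i with ⟨hi, h⟩ | ⟨-, h⟩
        · rw [h, hi]; exact hw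
        · rw [h]; exact (hleast _).1)
  -- Maximality at `a` bounds the count at `b` by `A.card`, whereas the minor has size `A.card + 1`.
  have hle : leadingCount m u.degree w b ≤ A.card := leadingCount_le m ha (Or.inr hwdeg) b
  rw [Fintype.card_coe, Finset.card_insert_of_notMem hwA] at hb
  omega

theorem matrixSubst_mem_span_genericExponents [Infinite k]
    (hm : ∀ i j : Fin n, i ≤ j → m.toSyn (Finsupp.single j 1) ≤ m.toSyn (Finsupp.single i 1))
    {M : Matrix (Fin n) (Fin n) k} (hM : M.BlockTriangular id) (hdiag : ∀ i, M i i ≠ 0)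
    {p : MvPolynomial (Fin n) k}
    (hp : p ∈ Ideal.span ((fun u => monomial u (1 : k)) '' genericExponents m d k)) :
    matrixSubst M p ∈ Ideal.span ((fun u => monomial u (1 : k)) '' genericExponents m d k) := by
  have hle : Ideal.span ((fun u => monomial u (1 : k)) '' genericExponents m d k) ≤
      (Ideal.span ((fun u => monomial u (1 : k)) '' genericExponents m d k)).comap
        (matrixSubst M) := by
    refine Ideal.span_le.2 ?_
    rintro _ ⟨u, hu, rfl⟩
    refine (mem_span_monomial_iff (fun u hu v => add_mem_genericExponents m hu v) _).2
      fun w hw => ?_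
    exact mem_genericExponents_of_mem_support hm hM hdiag hu (mem_support_iff.1 hw)
  exact hle hp

theorem diag_ne_zero_of_blockTriangular {α : GL (Fin n) k}
    (hα : (α : Matrix (Fin n) (Fin n) k).BlockTriangular id) (i : Fin n) :
    (α : Matrix (Fin n) (Fin n) k) i i ≠ 0 := by
  have hdet : (α : Matrix (Fin n) (Fin n) k).det ≠ 0 := (Matrix.GeneralLinearGroup.det α).ne_zero
  rw [Matrix.det_of_isUpperTriangular hα] at hdet
  exact Finset.prod_ne_zero_iff.1 hdet i (Finset.mem_univ i)

theorem isBorelFixed_span_genericExponents [Infinite k]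
    (hm : ∀ i j : Fin n, i ≤ j → m.toSyn (Finsupp.single j 1) ≤ m.toSyn (Finsupp.single i 1)) :
    IsBorelFixed (Ideal.span ((fun u => monomial u (1 : k)) '' genericExponents m d k)) := by
  intro α hα
  have hinv : ((α⁻¹ : GL (Fin n) k) : Matrix (Fin n) (Fin n) k).BlockTriangular id := by
    let _ : Invertible (α : Matrix (Fin n) (Fin n) k) := α.invertible
    rw [Matrix.coe_units_inv]
    exact Matrix.blockTriangular_inv_of_blockTriangular hα
  apply Set.Subset.antisymm
  · rintro _ ⟨p, hp, rfl⟩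
    exact matrixSubst_mem_span_genericExponents hm hα (diag_ne_zero_of_blockTriangular hα) hp
  · intro p hp
    have hmem := matrixSubst_mem_span_genericExponents hm hinv
      (diag_ne_zero_of_blockTriangular hinv) hp
    have hcancel := matrixSubst_matrixSubst (α : Matrix (Fin n) (Fin n) k)
      ((α⁻¹ : GL (Fin n) k) : Matrix (Fin n) (Fin n) k) p
    rw [Units.mul_inv, matrixSubst_one] at hcancel
    exact ⟨_, hmem, hcancel⟩

end Borel

/-! ### From leading exponents back to initial ideals. -/

theorem initialIdeal_eq_span_genericExponents_iff {k : Type*} [Field k] [Infinite k] {n s : ℕ}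
    {d : Fin s → ℕ} (m : MonomialOrder (Fin n)) (a : CoeffIndex n s d → k) :
    initialIdeal m (idealOfPoint a) =
        Ideal.span ((fun u => monomial u (1 : k)) '' genericExponents m d k) ↔
      leadingExponents m (idealOfPoint a) = genericExponents m d k := by
  rw [initialIdeal_eq_span_monomial]
  have hL : ∀ u ∈ leadingExponents m (idealOfPoint a), ∀ v,
      u + v ∈ leadingExponents m (idealOfPoint a) := fun u hu v => add_mem_leadingExponents m hu v
  have hG : ∀ u ∈ genericExponents m d k, ∀ v, u + v ∈ genericExponents m d k :=
    fun u hu v => add_mem_genericExponents m hu v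
  exact ⟨fun h => span_monomial_inj hL hG h, fun h => by rw [h]⟩

end GenericInitial

theorem theorem2p4 {k : Type*} [Field k] [Infinite k]
    (n s : ℕ) (hn : 0 < n) (hs : 0 < s) (d : Fin s → ℕ) (hd : ∀ i, 0 < d i)
    (m : MonomialOrder (Fin n))
    (hm : ∀ i j : Fin n, i ≤ j → m.toSyn (Finsupp.single j 1) ≤ m.toSyn (Finsupp.single i 1)) :
    ∃ J : Ideal (MvPolynomial (Fin n) k),
      GenericInitial.IsZariskiOpenDense
        {a : GenericInitial.CoeffIndex n s d → k |
          GenericInitial.initialIdeal m (GenericInitial.idealOfPoint a) = J} ∧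
      (∀ V : Set (GenericInitial.CoeffIndex n s d → k),
        GenericInitial.IsZariskiOpenDense V →
        (∀ a ∈ V, ∀ b ∈ V,
          GenericInitial.initialIdeal m (GenericInitial.idealOfPoint a) =
            GenericInitial.initialIdeal m (GenericInitial.idealOfPoint b)) →
        ∀ a ∈ V, GenericInitial.initialIdeal m (GenericInitial.idealOfPoint a) = J) ∧
      GenericInitial.IsBorelFixed J := by
  obtain ⟨hopen, hne⟩ :=
    GenericInitial.isOpen_nonempty_leadingExponents_eq (k := k) (d := d) m
  simp only [← GenericInitial.initialIdeal_eq_span_genericExponents_iff] at hopen hne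
  refine ⟨_, GenericInitial.isZariskiOpenDense_of_isOpen hopen hne, fun V hV hconst a ha => ?_,
    GenericInitial.isBorelFixed_span_genericExponents hm⟩
  -- By irreducibility `V` meets the generic locus, and one common point fixes the constant value on
  -- `V`.
  obtain ⟨b, hbV, hb⟩ := GenericInitial.nonempty_inter_of_isOpen hV.1 hopen ⟨a, ha⟩ hne
  exact (hconst a ha b hbV).trans hb
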